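/- An algebra is a nonempty set with a family of finitary operations of arbitrary type. A variety is a class of algebras of the same type closed under homomorphic images, subalgebras and direct products; it is congruence modular if every algebra in it has a modular congruence lattice. For congruences $\alpha,\beta$ of an algebra $\mathbf A$, the commutator $[\alpha,\beta]$ is the intersection of all congruences $\delta$ of $\mathbf A$ such that for all $n$, all $(n+1)$-ary term functions $t$ of $\mathbf A$, all $(a,b)\in\alpha$ and $(c_1,d_1),\dots,(c_n,d_n)\in\beta$ with $(t(a,c_1,\dots,c_n),t(a,d_1,\dots,d_n))\in\delta$, one has $(t(b,c_1,\dots,c_n),t(b,d_1,\dots,d_n))\in\delta$. Put $\gamma_1=1_A$ and $\gamma_{n+1}=[\gamma_n,\gamma_n]$; $\mathbf A$ is solvable if $\gamma_m=0_A$ for some $m\ge 1$. A lattice $\mathbf L$ forces a property $p$ in a class $K$ of algebras if every algebra in $K$ whose congruence lattice is isomorphic to $\mathbf L$ has the property $p$. **Theorem.** Let $\mathbf L$ be a lattice of finite height that is isomorphic to the congruence lattice of some algebra in a congruence modular variety. Then the following are equivalent: 1. $\mathbf L$ forces solvability in the class of all algebras that generate congruence modular varieties. 2. Every algebra $\mathbf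 B$ that generates a congruence modular variety and satisfies $\mathrm{Con}(\mathbf B)\cong\mathbf L$ is solvable. 3. The two-element lattice $\mathbf B_2$ is not a homomorphic image of $\mathbf L$. -/

import Mathlib

open scoped FirstOrder

universe u w

namespace UA

/-- A (nonempty, finitary) algebra of type `S`. Signatures are first-order languages with function
symbols; wherever algebras are used below, the language has no relation symbols. -/
structure AlgebraOver (S : FirstOrder.Language.{u, 0}) : Type (u + 1) where
  Carrier : Type u
  [nonempty : Nonempty Carrier]
  [str : S.Structure Carrier]

attribute [instance] AlgebraOver.nonempty AlgebraOver.str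

section Congruences

variable (S : FirstOrder.Language.{u, 0}) (A : Type u) [S.Structure A]

/-- Congruence relations: equivalence relations compatible with all fundamental operations. -/
@[ext]
structure Congruence : Type u where
  toSetoid : Setoid A
  compat : ∀ (n : ℕ) (f : S.Functions n) (x y : Fin n → A), (∀ i, toSetoid (x i) (y i)) →
    toSetoid (FirstOrder.Language.Structure.funMap f x)
      (FirstOrder.Language.Structure.funMap f y)

variable {S A}

namespace Congruence

/-- `θ.Rel a b` means that the pair `(a, b)` belongs to `θ`. -/
def Rel (θ : Congruence S A) (a b : A) : Prop := θ.toSetoid a b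

/-- Congruences are ordered by inclusion. -/
instance : PartialOrder (Congruence S A) where
  le θ ψ := ∀ a b, θ.Rel a b → ψ.Rel a b
  le_refl _ _ _ h := h
  le_trans _ _ _ h h' a b hab := h' a b (h a b hab)
  le_antisymm _ _ h h' := Congruence.ext (Setoid.ext fun a b => ⟨h a b, h' a b⟩)

theorem le_iff {θ ψ : Congruence S A} : θ ≤ ψ ↔ ∀ a b, θ.Rel a b → ψ.Rel a b := Iff.rfl

/-- The infimum of a set of congruences is its intersection. -/
instance : InfSet (Congruence S A) where
  sInf T :=
    { toSetoid := ⟨fun a b => ∀ θ ∈ T, θ.Rel a b,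
        fun _ θ _ => θ.toSetoid.refl _, fun h θ hθ => θ.toSetoid.symm (h θ hθ),
        fun h h' θ hθ => θ.toSetoid.trans (h θ hθ) (h' θ hθ)⟩
      compat := fun n f x y h θ hθ => θ.compat n f x y fun i => h i θ hθ }

theorem sInf_rel (T : Set (Congruence S A)) (a b : A) :
    (sInf T).Rel a b ↔ ∀ θ ∈ T, θ.Rel a b := Iff.rfl

theorem isGLB_sInf (T : Set (Congruence S A)) : IsGLB T (sInf T) :=
  ⟨fun θ hθ _ _ h => h θ hθ, fun _ hψ a b h _ hθ => hψ hθ a b h⟩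

/-- The congruence lattice. -/
instance : CompleteLattice (Congruence S A) :=
  completeLatticeOfInf (Congruence S A) isGLB_sInf

theorem top_rel (a b : A) : (⊤ : Congruence S A).Rel a b := by
  have h : (⟨⊤, fun _ _ _ _ _ => trivial⟩ : Congruence S A) ≤ ⊤ := le_top
  exact h a b trivial

theorem bot_rel (a b : A) : (⊥ : Congruence S A).Rel a b ↔ a = b := by
  constructor
  · intro h
    have h' : ⊥ ≤ (⟨⊥, fun _ f x y hxy =>
      congrArg (FirstOrder.Language.Structure.funMap f) (funext hxy)⟩ : Congruence S A) := bot_le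
    exact h' a b h
  · rintro rfl
    exact (⊥ : Congruence S A).toSetoid.refl a

theorem inf_rel (θ ψ : Congruence S A) (a b : A) :
    (θ ⊓ ψ).Rel a b ↔ θ.Rel a b ∧ ψ.Rel a b := by
  rw [← sInf_pair, sInf_rel]
  simp

end Congruence

/-- The term condition for the pair `(α, β)` modulo `δ`, quantified over all `(n+1)`-ary term
functions. -/
def TermCondition (α β δ : Congruence S A) : Prop :=
  ∀ (n : ℕ) (t : S.Term (Fin (n + 1))) (a b : A) (c d : Fin n → A),
    α.Rel a b → (∀ i, β.Rel (c i) (d i)) →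
    δ.Rel (t.realize (Fin.cons a c : Fin (n + 1) → A))
      (t.realize (Fin.cons a d : Fin (n + 1) → A)) →
    δ.Rel (t.realize (Fin.cons b c : Fin (n + 1) → A))
      (t.realize (Fin.cons b d : Fin (n + 1) → A))

/-- The term condition commutator `[α, β]`. -/
def commutator (α β : Congruence S A) : Congruence S A :=
  sInf {δ | TermCondition α β δ}

variable (S A)

/-- The derived series; the indexing starts at `0`, that is, `derivedSeries S A 0 = ⊤`. -/
def derivedSeries : ℕ → Congruence S A
  | 0 => ⊤
  | n + 1 => commutator (derivedSeries n) (derivedSeries n)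

end Congruences

namespace AlgebraOver

variable {S : FirstOrder.Language.{u, 0}}

/-- The congruence lattice of an algebra. -/
abbrev Con (A : AlgebraOver S) : Type u := Congruence S A.Carrier

/-- The subalgebra of `A` on a nonempty subuniverse `B`. -/
def subalgebra (A : AlgebraOver S) (B : S.Substructure A.Carrier) (h : Nonempty B) :
    AlgebraOver S where
  Carrier := B
  nonempty := h

/-- The direct product of a family of algebras, with coordinatewise operations. -/
def product {ι : Type u} (A : ι → AlgebraOver S) : AlgebraOver S where
  Carrier := ∀ i, (A i).Carrier
  str :=
    { funMap := fun f x i => FirstOrder.Language.Structure.funMap f fun j => x j i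
      RelMap := fun r x => ∀ i, FirstOrder.Language.Structure.RelMap r fun j => x j i }

end AlgebraOver

section Varieties

variable {S : FirstOrder.Language.{u, 0}}

/-- A variety: a class of algebras of the same type that is closed under homomorphic images,
subalgebras and direct products. -/
structure IsVariety (V : Set (AlgebraOver S)) : Prop where
  hom_mem : ∀ A ∈ V, ∀ (B : AlgebraOver S) (f : A.Carrier →[S] B.Carrier),
    Function.Surjective f → B ∈ V
  sub_mem : ∀ A ∈ V, ∀ (B : S.Substructure A.Carrier) (h : Nonempty B), A.subalgebra B h ∈ V
  prod_mem : ∀ (ι : Type u) (A : ι → AlgebraOver S), (∀ i, A i ∈ V) →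
    AlgebraOver.product A ∈ V

/-- The variety generated by `A`: the smallest variety that contains `A`. -/
def generatedVariety (A : AlgebraOver S) : Set (AlgebraOver S) :=
  ⋂₀ {V | IsVariety V ∧ A ∈ V}

/-- A class of algebras is congruence modular if all its members have modular congruence
lattices. -/
def IsCongruenceModular (V : Set (AlgebraOver S)) : Prop :=
  ∀ A ∈ V, IsModularLattice A.Con

theorem isVariety_generatedVariety (A : AlgebraOver S) : IsVariety (generatedVariety A) where
  hom_mem B hB C f hf V hV := hV.1.hom_mem B (hB V hV) C f hf
  sub_mem B hB C h V hV := hV.1.sub_mem B (hB V hV) C h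
  prod_mem ι B hB V hV := hV.1.prod_mem ι B fun i => hB i V hV

theorem mem_generatedVariety (A : AlgebraOver S) : A ∈ generatedVariety A := fun _ hV => hV.2

end Varieties

/-- A universal algebra of arbitrary type. -/
structure UniversalAlgebra : Type (u + 1) where
  sig : FirstOrder.Language.{u, 0}
  [algebraic : sig.IsAlgebraic]
  alg : AlgebraOver sig

namespace UniversalAlgebra

/-- The congruence lattice of a universal algebra. -/
abbrev Con (A : UniversalAlgebra.{u}) : Type u := A.alg.Con

/-- The algebra belongs to some congruence modular variety. -/
def InCongruenceModularVariety (A : UniversalAlgebra.{u}) : Prop :=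
  ∃ V : Set (AlgebraOver A.sig), IsVariety V ∧ IsCongruenceModular V ∧ A.alg ∈ V

/-- The algebra generates a congruence modular variety. -/
def GeneratesCongruenceModularVariety (A : UniversalAlgebra.{u}) : Prop :=
  IsCongruenceModular (generatedVariety A.alg)

/-- Some term of the derived series is the equality relation. -/
def IsSolvable (A : UniversalAlgebra.{u}) : Prop :=
  ∃ m : ℕ, derivedSeries A.sig A.alg.Carrier m = ⊥

end UniversalAlgebra

/-- The lattice `L` forces the property `p` in the class `K` of algebras. -/
def Forces (L : Type w) [Lattice L] (p : UniversalAlgebra.{u} → Prop)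
    (K : Set UniversalAlgebra.{u}) : Prop :=
  ∀ A ∈ K, Nonempty (A.Con ≃o L) → p A

/-- The lattice `M` is a homomorphic image of the lattice `L`. -/
def IsHomomorphicImage (M : Type*) (L : Type*) [Lattice M] [Lattice L] : Prop :=
  ∃ h : LatticeHom L M, Function.Surjective h

end UA

/-! If `L` maps onto the two-element lattice, finite height splits it: some `b ≰ a` such that each
element is above `b` or below `a`. For the corresponding congruences β, α, take (o, e) in β but not
in α, and adjoin the operation that is e when both arguments are α-related to e and o otherwise. It
preserves all congruences: those above β identify its two values, those below α do not affect which
value is taken. As (o, e) generates β and the operation is a meet on {o, e}, the term condition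
keeps β below the whole derived series (`exists_expand_not_isSolvable`).

Conversely, in a nonsolvable algebra the derived series stops at a nonzero perfect congruence. In
the modular case the commutator is commutative and join-additive, which makes a minimal nonzero
perfect congruence join prime; its principal filter and the complement give the map
(`exists_latticeHom_bool_of_perfect`). Additivity and symmetry come from the Shifting Lemma in the
subalgebra β of the square. -/

namespace UA

open FirstOrder.Language
open FirstOrder.Language.Structure (funMap RelMap)

/-- A map that preserves relatedness in each coordinate separately preserves it in all
coordinates jointly. -/
theorem rel_of_forall_update {A B : Type*} {n : ℕ} (r : Setoid B) (s : A → A → Prop)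
    (f : (Fin n → A) → B)
    (h : ∀ x i a b, s a b → r (f (Function.update x i a)) (f (Function.update x i b)))
    (x y : Fin n → A) (hxy : ∀ i, s (x i) (y i)) : r (f x) (f y) := by
  classical
  have key : ∀ t : Finset (Fin n), r (f x) (f (t.piecewise y x)) := by
    intro t
    induction t using Finset.induction_on with
    | empty => simp
    | insert j t hj ih =>
      refine r.trans ih ?_
      rw [Finset.piecewise_insert]
      have := h (t.piecewise y x) j (x j) (y j) (hxy j)
      rwa [Function.update_eq_self_iff.2 (Finset.piecewise_eq_of_notMem _ _ _ hj).symm] at this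
  simpa using key Finset.univ

/-! ### Translations, syntactic congruences and centralizers -/

section Polynomials

variable {S : FirstOrder.Language.{u, 0}} {A B : Type u} [S.Structure A] [S.Structure B]

variable (S) in
/-- Translations: compositions of fundamental operations with all but one argument fixed. -/
inductive IsTranslation : (A → A) → Prop
  | id : IsTranslation id
  | comp {p : A → A} (hp : IsTranslation p) {n : ℕ} (f : S.Functions n) (x : Fin n → A)
      (i : Fin n) : IsTranslation fun a => p (funMap f (Function.update x i a))

theorem IsTranslation.exists_term {p : A → A} (hp : IsTranslation S p) :
    ∃ (n : ℕ) (t : S.Term (Fin (n + 1))) (e : Fin n → A),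
      ∀ a, p a = t.realize (Fin.cons a e : Fin (n + 1) → A) := by
  -- An arbitrary finite parameter set lets the induction add parameters without renumbering;
  -- numbering happens once, here.
  suffices h : ∃ (V : Type) (_ : Finite V) (t : S.Term (Option V)) (e : V → A),
      ∀ a, p a = t.realize fun o => o.elim a e by
    obtain ⟨V, _, t, e, h⟩ := h
    obtain ⟨n, ⟨g⟩⟩ := Finite.exists_equiv_fin V
    refine ⟨n, t.relabel fun o => o.elim 0 fun v => (g v).succ, e ∘ g.symm, fun a => ?_⟩
    rw [h, Term.realize_relabel]
    congr 1
    funext o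
    cases o <;> simp
  induction hp with
  | id => exact ⟨Empty, inferInstance, Term.var none, Empty.elim, fun a => rfl⟩
  | @comp p hp n f x i ih =>
    obtain ⟨V, _, t, e, h⟩ := ih
    refine ⟨V ⊕ Fin n, inferInstance,
      t.subst fun o => o.elim
        (Term.func f fun j => if j = i then Term.var none else Term.var (some (Sum.inr j)))
        fun v => Term.var (some (Sum.inl v)), Sum.elim e x, fun a => ?_⟩
    beta_reduce
    rw [h, Term.realize_subst]
    congr 1
    funext o
    cases o with
    | none =>
      simp only [Option.elim_none, Term.realize_func]
      congr 1
      funext j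
      by_cases hj : j = i
      · subst hj; simp
      · simp [hj]
    | some v => simp

namespace Congruence

theorem refl (θ : Congruence S A) (a : A) : θ.Rel a a := θ.toSetoid.refl a

theorem symm (θ : Congruence S A) {a b : A} (h : θ.Rel a b) : θ.Rel b a := θ.toSetoid.symm h

theorem trans (θ : Congruence S A) {a b c : A} (h : θ.Rel a b) (h' : θ.Rel b c) : θ.Rel a c :=
  θ.toSetoid.trans h h'

theorem rel_realize (θ : Congruence S A) {V : Type*} (t : S.Term V) (x y : V → A)
    (h : ∀ v, θ.Rel (x v) (y v)) : θ.Rel (t.realize x) (t.realize y) := by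
  induction t with
  | var v => exact h v
  | func f ts ih => exact θ.compat _ f _ _ ih

/-- The preimage of a congruence under a map that commutes with the operations. -/
def comap (f : A → B)
    (hf : ∀ (n : ℕ) (F : S.Functions n) (x : Fin n → A), f (funMap F x) = funMap F (f ∘ x))
    (θ : Congruence S B) : Congruence S A where
  toSetoid := θ.toSetoid.comap f
  compat n F x y h := by
    simp only [Setoid.comap_rel, hf] at h ⊢
    exact θ.compat n F _ _ h

variable (S) in
/-- The syntactic congruence of a set: the largest congruence for which the set is a union of
congruence classes. -/
def syntactic (P : Set A) : Congruence S A where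
  toSetoid :=
    ⟨fun a b => ∀ p : A → A, IsTranslation S p → (p a ∈ P ↔ p b ∈ P),
      fun _ _ _ => Iff.rfl, fun h p hp => (h p hp).symm,
      fun h h' p hp => (h p hp).trans (h' p hp)⟩
  compat n f x y h := by
    refine rel_of_forall_update _ (fun a b => ∀ p : A → A, IsTranslation S p → (p a ∈ P ↔ p b ∈ P))
      (funMap f) (fun x i a b hab p hp => ?_) x y h
    exact hab _ (hp.comp f x i)

theorem mem_iff_of_syntactic_rel {P : Set A} {a b : A} (h : (syntactic S P).Rel a b) :
    a ∈ P ↔ b ∈ P := h _ .id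

/-- The Shifting Lemma. -/
theorem shifting [IsModularLattice (Congruence S A)] {α β γ : Congruence S A} (h : α ⊓ β ≤ γ)
    {a b c d : A} (hab : α.Rel a b) (hcd : α.Rel c d) (hac : β.Rel a c) (hbd : β.Rel b d)
    (hγ : γ.Rel b d) : γ.Rel a c := by
  -- The path a, b, d, c lies in (β ∧ γ) ∨ α; the modular law then turns the meet with β into (β ∧
  -- γ) ∨ (α ∧ β), which is below γ.
  have h1 : ((β ⊓ γ ⊔ α) ⊓ β).Rel a c := by
    refine (inf_rel _ _ _ _).2 ⟨?_, hac⟩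
    have hα : α ≤ β ⊓ γ ⊔ α := le_sup_right
    have hβ : β ⊓ γ ≤ β ⊓ γ ⊔ α := le_sup_left
    exact trans _ (hα _ _ hab) (trans _ (hβ _ _ ((inf_rel _ _ _ _).2 ⟨hbd, hγ⟩))
      (symm _ (hα _ _ hcd)))
  rw [sup_inf_assoc_of_le _ inf_le_left] at h1
  exact (sup_le inf_le_right h : β ⊓ γ ⊔ α ⊓ β ≤ γ) _ _ h1

/-- The congruence `β` as a subset of `A × A`. -/
def Pairs (β : Congruence S A) : Type u := {p : A × A // β.Rel p.1 p.2}

/-- The congruence `β` as a subalgebra of the square of the algebra. -/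
instance (β : Congruence S A) : S.Structure β.Pairs where
  funMap f x := ⟨(funMap f fun i => (x i).1.1, funMap f fun i => (x i).1.2),
    β.compat _ f _ _ fun i => (x i).2⟩
  RelMap _ _ := True

namespace Pairs

variable {β : Congruence S A}

/-- The first coordinate. -/
def fst (z : β.Pairs) : A := z.1.1

/-- The second coordinate. -/
def snd (z : β.Pairs) : A := z.1.2

theorem rel (z : β.Pairs) : β.Rel z.fst z.snd := z.2

/-- The pair with given related coordinates. -/
def mk (a b : A) (h : β.Rel a b) : β.Pairs := ⟨(a, b), h⟩

variable (β) in
/-- The diagonal embedding. -/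
def diag (a : A) : β.Pairs := mk a a (β.refl a)

theorem ext {z w : β.Pairs} (h : z.fst = w.fst) (h' : z.snd = w.snd) : z = w :=
  Subtype.ext (Prod.ext h h')

theorem fst_realize {V : Type*} (t : S.Term V) (x : V → β.Pairs) :
    (t.realize x).fst = t.realize (fst ∘ x) := by
  induction t with
  | var v => rfl
  | func f ts ih => exact congrArg (funMap f) (funext ih)

theorem snd_realize {V : Type*} (t : S.Term V) (x : V → β.Pairs) :
    (t.realize x).snd = t.realize (snd ∘ x) := by
  induction t with
  | var v => rfl
  | func f ts ih => exact congrArg (funMap f) (funext ih)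

theorem fst_realize_cons {n : ℕ} (t : S.Term (Fin (n + 1))) (z : β.Pairs)
    (e : Fin n → β.Pairs) : (t.realize (Fin.cons z e : Fin (n + 1) → β.Pairs)).fst =
      t.realize (Fin.cons z.fst (fst ∘ e) : Fin (n + 1) → A) := by
  rw [fst_realize]
  congr 1
  funext i
  cases i using Fin.cases <;> rfl

theorem snd_realize_cons {n : ℕ} (t : S.Term (Fin (n + 1))) (z : β.Pairs)
    (e : Fin n → β.Pairs) : (t.realize (Fin.cons z e : Fin (n + 1) → β.Pairs)).snd =
      t.realize (Fin.cons z.snd (snd ∘ e) : Fin (n + 1) → A) := by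
  rw [snd_realize]
  congr 1
  funext i
  cases i using Fin.cases <;> rfl

end Pairs

/-- The pairs in `β` whose first coordinates are related by `δ`. -/
def fstComap (β δ : Congruence S A) : Congruence S β.Pairs :=
  comap Pairs.fst (fun _ _ _ => rfl) δ

/-- The pairs in `β` whose second coordinates are related by `δ`. -/
def sndComap (β δ : Congruence S A) : Congruence S β.Pairs :=
  comap Pairs.snd (fun _ _ _ => rfl) δ

theorem fstComap_rel {β δ : Congruence S A} {z w : β.Pairs} :
    (fstComap β δ).Rel z w ↔ δ.Rel z.fst w.fst := Iff.rfl

theorem sndComap_rel {β δ : Congruence S A} {z w : β.Pairs} :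
    (sndComap β δ).Rel z w ↔ δ.Rel z.snd w.snd := Iff.rfl

/-- The largest congruence of the algebra `β` for which the set of the pairs that belong to `δ`
is a union of classes. -/
def pairSyntactic (β δ : Congruence S A) : Congruence S β.Pairs :=
  syntactic S {z | δ.Rel z.fst z.snd}

theorem rel_iff_of_pairSyntactic {β δ : Congruence S A} {z w : β.Pairs}
    (h : (pairSyntactic β δ).Rel z w) : δ.Rel z.fst z.snd ↔ δ.Rel w.fst w.snd :=
  mem_iff_of_syntactic_rel h

/-- The largest congruence that centralizes `β` modulo `δ`. -/
def centralizer (β δ : Congruence S A) : Congruence S A :=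
  comap (Pairs.diag β) (fun _ _ _ => rfl) (pairSyntactic β δ)

end Congruence

open Congruence

/-- A term with parameters from β acts on diagonal pairs as a unary polynomial of the algebra β. The
term condition says that such polynomials cannot tell α-related diagonal pairs apart by membership
in δ. -/
theorem termCondition_iff_le_centralizer {α β δ : Congruence S A} :
    TermCondition α β δ ↔ α ≤ centralizer β δ := by
  constructor
  · intro h a b hab p hp
    obtain ⟨n, t, e, hp⟩ := hp.exists_term
    have key : ∀ a b, α.Rel a b → δ.Rel (p (Pairs.diag β a)).fst (p (Pairs.diag β a)).snd →
        δ.Rel (p (Pairs.diag β b)).fst (p (Pairs.diag β b)).snd := by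
      intro a b hab hδ
      rw [hp, Pairs.fst_realize_cons, Pairs.snd_realize_cons] at hδ ⊢
      exact h n t a b _ _ hab (fun i => (e i).rel) hδ
    exact ⟨key a b hab, key b a (α.symm hab)⟩
  · intro h n t a b c d hab hcd hδ
    have h1 : (pairSyntactic β δ).Rel
        (t.realize (Fin.cons (Pairs.diag β a) fun i => Pairs.mk _ _ (hcd i)
          : Fin (n + 1) → β.Pairs))
        (t.realize (Fin.cons (Pairs.diag β b) fun i => Pairs.mk _ _ (hcd i)
          : Fin (n + 1) → β.Pairs)) := by
      refine rel_realize _ _ _ _ fun i => ?_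
      cases i using Fin.cases with
      | zero => exact h a b hab
      | succ i => exact refl _ _
    have h2 := rel_iff_of_pairSyntactic h1
    simp only [Pairs.fst_realize_cons, Pairs.snd_realize_cons] at h2
    exact h2.1 hδ

theorem termCondition_sInf {α β : Congruence S A} {T : Set (Congruence S A)}
    (h : ∀ δ ∈ T, TermCondition α β δ) : TermCondition α β (sInf T) :=
  fun n t a b c d hab hcd hδ δ hT => h δ hT n t a b c d hab hcd (hδ δ hT)

theorem termCondition_commutator (α β : Congruence S A) :
    TermCondition α β (commutator α β) :=
  termCondition_sInf fun _ h => h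

theorem termCondition_left (α β : Congruence S A) : TermCondition α β α := by
  intro n t a b c d hab hcd h
  have key : ∀ x : Fin n → A, α.Rel (t.realize (Fin.cons a x : Fin (n + 1) → A))
      (t.realize (Fin.cons b x : Fin (n + 1) → A)) := by
    refine fun x => rel_realize _ _ _ _ fun i => ?_
    cases i using Fin.cases with
    | zero => exact hab
    | succ i => exact refl _ _
  exact α.trans (α.symm (key c)) (α.trans h (key d))

theorem commutator_le_left (α β : Congruence S A) : commutator α β ≤ α :=
  sInf_le (termCondition_left α β)

/-! ### The commutator under modularity -/

section Modular

variable {α β δ δ' : Congruence S A} [IsModularLattice (Congruence S β.Pairs)]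

theorem pairSyntactic_inf_le (β δ : Congruence S A) [IsModularLattice (Congruence S β.Pairs)] :
    pairSyntactic β δ ⊓ sndComap β ⊥ ≤ fstComap β δ := by
  intro z w h
  obtain ⟨h1, h2⟩ := (inf_rel _ _ _ _).1 h
  rw [sndComap_rel, bot_rel] at h2
  have hu : β.Rel w.fst z.fst := β.trans (h2 ▸ w.rel) (β.symm z.rel)
  -- With z = (x, s) and w = (y, s), shifting along the two projection kernels, which meet in zero,
  -- moves the pair (z, w) to ((x, x), (y, x)).
  have h3 : (pairSyntactic β δ).Rel (Pairs.diag β z.fst) (Pairs.mk _ _ hu) := by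
    refine shifting (α := fstComap β ⊥) (β := sndComap β ⊥) (b := z) (d := w) ?_
      ((bot_rel _ _).2 rfl) ((bot_rel _ _).2 rfl) ((bot_rel _ _).2 rfl) ((bot_rel _ _).2 h2) h1
    intro x y hxy
    obtain ⟨h3, h4⟩ := (inf_rel _ _ _ _).1 hxy
    rw [fstComap_rel, bot_rel] at h3
    rw [sndComap_rel, bot_rel] at h4
    rw [Pairs.ext h3 h4]
    exact refl _ _
  exact δ.symm ((rel_iff_of_pairSyntactic h3).1 (δ.refl _))

/-- Shifting between the pair (t(·, c), t(·, d)) and the diagonal pair of t(·, d), at a and at b: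
second coordinates agree, and `pairSyntactic_inf_le` bounds the meet by δ, hence by any larger δ'.
-/
theorem TermCondition.mono_right (h : TermCondition α β δ) (hδ : δ ≤ δ') :
    TermCondition α β δ' := by
  rw [termCondition_iff_le_centralizer] at h
  intro n t a b c d hab hcd hrel
  have h1 : (pairSyntactic β δ).Rel
      (t.realize (Fin.cons (Pairs.diag β a) fun i => Pairs.mk _ _ (hcd i)
        : Fin (n + 1) → β.Pairs))
      (t.realize (Fin.cons (Pairs.diag β b) fun i => Pairs.mk _ _ (hcd i)
        : Fin (n + 1) → β.Pairs)) := by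
    refine rel_realize _ _ _ _ fun i => ?_
    cases i using Fin.cases with
    | zero => exact h a b hab
    | succ i => exact refl _ _
  have h2 : α.Rel (t.realize (Fin.cons a d : Fin (n + 1) → A))
      (t.realize (Fin.cons b d : Fin (n + 1) → A)) := by
    refine rel_realize _ _ _ _ fun i => ?_
    cases i using Fin.cases with
    | zero => exact hab
    | succ i => exact refl _ _
  have h3 := shifting (α := pairSyntactic β δ) (β := sndComap β ⊥) (γ := fstComap β δ')
    ((pairSyntactic_inf_le β δ).trans fun _ _ h => hδ _ _ h) (symm _ h1) (symm _ (h _ _ h2))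
    ((bot_rel _ _).2 (Pairs.snd_realize_cons _ _ _)) ((bot_rel _ _).2 (Pairs.snd_realize_cons _ _ _))
    (by rw [fstComap_rel, Pairs.fst_realize_cons]; exact hrel)
  rw [fstComap_rel, Pairs.fst_realize_cons] at h3
  exact h3

/-- The roles in the shifting rectangle are exchanged: the syntactic congruence now joins the c-side
to the d-side, and equality of second coordinates joins each pair to a diagonal one. -/
theorem TermCondition.symm (h : TermCondition α β δ) : TermCondition β α δ := by
  rw [termCondition_iff_le_centralizer] at h
  intro n t a b c d hab hcd hrel
  have h1 : (pairSyntactic β δ).Rel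
      (t.realize (Fin.cons (Pairs.mk _ _ hab) fun i => Pairs.diag β (c i)
        : Fin (n + 1) → β.Pairs))
      (t.realize (Fin.cons (Pairs.mk _ _ hab) fun i => Pairs.diag β (d i)
        : Fin (n + 1) → β.Pairs)) := by
    refine rel_realize _ _ _ _ fun i => ?_
    cases i using Fin.cases with
    | zero => exact refl _ _
    | succ i => exact h _ _ (hcd i)
  have h2 : α.Rel (t.realize (Fin.cons b c : Fin (n + 1) → A))
      (t.realize (Fin.cons b d : Fin (n + 1) → A)) := by
    refine rel_realize _ _ _ _ fun i => ?_
    cases i using Fin.cases with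
    | zero => exact refl _ _
    | succ i => exact hcd i
  exact shifting (α := sndComap β ⊥) (β := pairSyntactic β δ) (γ := fstComap β δ)
    (a := Pairs.diag β (t.realize (Fin.cons b c : Fin (n + 1) → A)))
    (c := Pairs.diag β (t.realize (Fin.cons b d : Fin (n + 1) → A)))
    (by rw [inf_comm]; exact pairSyntactic_inf_le β δ)
    (by rw [sndComap_rel, Pairs.snd_realize_cons]; exact refl _ _)
    (by rw [sndComap_rel, Pairs.snd_realize_cons]; exact refl _ _) (h _ _ h2) h1
    (by rw [fstComap_rel, Pairs.fst_realize_cons, Pairs.fst_realize_cons]; exact hrel)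

end Modular

/-- This adjunction between [·, β] and the centralizer is what makes the commutator additive. It
needs upward closure of the term condition in δ. -/
theorem commutator_le_iff {α β δ : Congruence S A} [IsModularLattice (Congruence S β.Pairs)] :
    commutator α β ≤ δ ↔ α ≤ centralizer β δ := by
  rw [← termCondition_iff_le_centralizer]
  exact ⟨(termCondition_commutator α β).mono_right, fun h => sInf_le h⟩

theorem commutator_sup_left (α α' β : Congruence S A) [IsModularLattice (Congruence S β.Pairs)] :
    commutator (α ⊔ α') β = commutator α β ⊔ commutator α' β :=
  eq_of_forall_ge_iff fun δ => by
    rw [sup_le_iff, commutator_le_iff, commutator_le_iff, commutator_le_iff, sup_le_iff]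

theorem commutator_comm (hM : ∀ β : Congruence S A, IsModularLattice (Congruence S β.Pairs))
    (α β : Congruence S A) : commutator α β = commutator β α :=
  have key : ∀ α β : Congruence S A, commutator β α ≤ commutator α β := fun α β =>
    haveI := hM β
    sInf_le (termCondition_commutator α β).symm
  le_antisymm (key β α) (key α β)

end Polynomials

/-! ### Lattice homomorphisms onto the two-element lattice -/

section Lattices

variable {L : Type*} [Lattice L]

theorem exists_latticeHom_bool_of_join_prime [OrderBot L] {b : L} (hb : b ≠ ⊥)
    (h : ∀ x y, b ≤ x ⊔ y → b ≤ x ∨ b ≤ y) :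
    ∃ f : LatticeHom L Bool, Function.Surjective f := by
  classical
  refine ⟨{ toFun := fun x => decide (b ≤ x), map_sup' := fun x y => ?_,
            map_inf' := fun x y => ?_ }, fun c => ?_⟩
  · rw [Bool.eq_iff_iff]
    simp only [Bool.sup_eq_bor, Bool.or_eq_true, decide_eq_true_eq]
    exact ⟨h x y, fun h => h.elim le_sup_of_le_left le_sup_of_le_right⟩
  · rw [Bool.eq_iff_iff]
    simp
  · cases c
    · exact ⟨⊥, by simpa using hb⟩
    · exact ⟨b, by simp⟩

/-- In a well-founded lattice with a join-additive commutator operation, a nonzero perfect element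
yields a homomorphism onto the two-element lattice. -/
theorem exists_latticeHom_bool_of_perfect [OrderBot L] [WellFoundedLT L] (c : L → L → L)
    (comm : ∀ x y, c x y = c y x) (le_left : ∀ x y, c x y ≤ x)
    (sup_left : ∀ x y z, c (x ⊔ y) z = c x z ⊔ c y z) {g : L} (hg : g ≠ ⊥) (hgg : c g g = g) :
    ∃ f : LatticeHom L Bool, Function.Surjective f := by
  obtain ⟨b, ⟨hb, hbb⟩, hmin⟩ := wellFounded_lt.has_min {b : L | b ≠ ⊥ ∧ c b b = b} ⟨g, hg, hgg⟩
  refine exists_latticeHom_bool_of_join_prime hb fun x y hxy => ?_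
  have mono : ∀ {x y}, x ≤ y → ∀ z, c x z ≤ c y z := fun {x y} h z => by
    rw [← sup_eq_right.2 h, sup_left]
    exact le_sup_left
  have hdec : c x b ⊔ c y b = b := by
    rw [← sup_left]
    refine le_antisymm (by rw [comm]; exact le_left _ _) ?_
    calc b = c b b := hbb.symm
      _ ≤ _ := mono hxy _
  have hle : c y b ≤ y := le_left _ _
  set y' := c y b
  -- A minimal complement z of y' below [x, b] is perfect, since [z, z] also joins with y' to b.
  -- Minimality of b then leaves only z = ⊥, giving b ≤ y, or z = b, giving b ≤ x.
  obtain ⟨z, ⟨hzx, hz⟩, hzmin⟩ :=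
    wellFounded_lt.has_min {z : L | z ≤ c x b ∧ z ⊔ y' = b} ⟨c x b, le_rfl, hdec⟩
  have hzb : z ≤ b := hz ▸ le_sup_left
  have hzz : c z z = z := by
    refine (le_left z z).eq_of_not_lt fun hlt => hzmin _ ⟨hlt.le.trans hzx, ?_⟩ hlt
    refine le_antisymm (sup_le (hlt.le.trans hzb) (hz ▸ le_sup_right)) ?_
    calc b = c (z ⊔ y') (z ⊔ y') := by rw [hz, hbb]
      _ = c z z ⊔ c y' z ⊔ c y' (z ⊔ y') := by rw [sup_left, comm z, sup_left]
      _ ≤ c z z ⊔ y' :=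
        sup_le (sup_le le_sup_left (le_sup_of_le_right (le_left _ _)))
          (le_sup_of_le_right (le_left _ _))
  by_cases hz0 : z = ⊥
  · right
    rw [← hz, hz0, bot_sup_eq]
    exact hle
  · left
    rw [← hzb.eq_of_not_lt (hmin z ⟨hz0, hzz⟩)]
    exact hzx.trans (le_left _ _)

theorem wellFoundedLT_of_finiteDimensionalOrder (L : Type*) [Preorder L]
    [FiniteDimensionalOrder L] : WellFoundedLT L :=
  ⟨(SetRel.IsWellFounded.of_finiteDimensional {(a, b) : L × L | a < b})⟩

theorem wellFoundedGT_of_finiteDimensionalOrder (L : Type*) [Preorder L]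
    [FiniteDimensionalOrder L] : WellFoundedGT L :=
  ⟨(SetRel.IsWellFounded.inv_of_finiteDimensional {(a, b) : L × L | a < b})⟩

/-- A homomorphism onto the two-element lattice splits a lattice of finite height into a principal
filter and a principal ideal. -/
theorem exists_splitting [WellFoundedLT L] [WellFoundedGT L] (f : LatticeHom L Bool)
    (hf : Function.Surjective f) :
    ∃ a b : L, ¬ b ≤ a ∧ ∀ x, b ≤ x ∨ x ≤ a := by
  -- The fibre over `true` is closed under meets, so its minimal element is least; dually for the
  -- fibre over `false`.
  obtain ⟨b, hb, hmin⟩ := wellFounded_lt.has_min {x | f x = true} (hf true)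
  obtain ⟨a, ha, hmax⟩ := wellFounded_gt.has_min {x | f x = false} (hf false)
  refine ⟨a, b, fun hba => ?_, fun x => ?_⟩
  · have h := OrderHomClass.mono f hba
    rw [show f b = true from hb, show f a = false from ha] at h
    exact absurd h (by decide)
  · cases hx : f x
    · right
      have h : f (x ⊔ a) = false := by rw [map_sup, hx, show f a = false from ha]; rfl
      exact sup_eq_right.1 ((le_sup_right : a ≤ x ⊔ a).eq_of_not_lt (hmax _ h)).symm
    · left
      have h : f (x ⊓ b) = true := by rw [map_inf, hx, show f b = true from hb]; rfl
      exact inf_eq_right.1 ((inf_le_right : x ⊓ b ≤ b).eq_of_not_lt (hmin _ h))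

end Lattices

/-! ### Squares and reducts in varieties -/

section Varieties

open Congruence

variable {S S' : FirstOrder.Language.{u, 0}}

/-- The congruence `β` as an algebra. -/
def pairAlgebra (A : AlgebraOver S) (β : A.Con) : AlgebraOver S where
  Carrier := β.Pairs
  nonempty := A.nonempty.map (Pairs.diag β)

theorem pairAlgebra_mem {V : Set (AlgebraOver S)} (hV : IsVariety V) {A : AlgebraOver S}
    (hA : A ∈ V) (β : A.Con) : pairAlgebra A β ∈ V := by
  let P := AlgebraOver.product fun _ : ULift.{u} Bool => A
  let B : S.Substructure P.Carrier :=
    { carrier := {x | β.Rel (x ⟨false⟩) (x ⟨true⟩)}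
      fun_mem := fun f x hx => β.compat _ f _ _ hx }
  have hB : Nonempty B := A.nonempty.map fun a => ⟨fun _ => a, β.refl a⟩
  let g : (P.subalgebra B hB).Carrier →[S] (pairAlgebra A β).Carrier :=
    { toFun := fun x => Pairs.mk (β := β) (x.1 ⟨false⟩) (x.1 ⟨true⟩) x.2
      map_fun' := fun f x => rfl
      map_rel' := fun r x _ => trivial }
  refine hV.hom_mem _ (hV.sub_mem _ (hV.prod_mem _ _ fun _ => hA) B hB) _ g fun z => ?_
  exact ⟨⟨fun i => if i.down then z.snd else z.fst, z.rel⟩, rfl⟩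

/-- The reduct of an algebra along a map of signatures. -/
def reductAlgebra (φ : S →ᴸ S') (A : AlgebraOver S') : AlgebraOver S where
  Carrier := A.Carrier
  str := φ.reduct A.Carrier

/-- Subalgebras and products commute with reducts up to an identity map, so closure under
homomorphic images finishes those cases. -/
theorem isVariety_preimage_reduct (φ : S →ᴸ S') {V : Set (AlgebraOver S)} (hV : IsVariety V) :
    IsVariety {A : AlgebraOver S' | reductAlgebra φ A ∈ V} where
  hom_mem A hA B f hf := by
    let g : (reductAlgebra φ A).Carrier →[S] (reductAlgebra φ B).Carrier :=
      { toFun := f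
        map_fun' := fun F x => f.map_fun' (φ.onFunction F) x
        map_rel' := fun r x => f.map_rel' (φ.onRelation r) x }
    exact hV.hom_mem _ hA _ g hf
  sub_mem A hA B hB := by
    let B' : S.Substructure (reductAlgebra φ A).Carrier :=
      { carrier := B.carrier
        fun_mem := fun F => B.fun_mem (φ.onFunction F) }
    let g : ((reductAlgebra φ A).subalgebra B' hB).Carrier →[S]
        (reductAlgebra φ (A.subalgebra B hB)).Carrier :=
      { toFun := fun x => x
        map_fun' := fun F x => rfl
        map_rel' := fun r x h => h }
    exact hV.hom_mem _ (hV.sub_mem _ hA B' hB) _ g fun x => ⟨x, rfl⟩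
  prod_mem ι A hA := by
    let g : (AlgebraOver.product fun i => reductAlgebra φ (A i)).Carrier →[S]
        (reductAlgebra φ (AlgebraOver.product A)).Carrier :=
      { toFun := fun x => x
        map_fun' := fun F x => rfl
        map_rel' := fun r x h => h }
    exact hV.hom_mem _ (hV.prod_mem ι _ hA) _ g fun x => ⟨x, rfl⟩

/-- A congruence, regarded as a congruence of a reduct. -/
def reductCongruence (φ : S →ᴸ S') (A : AlgebraOver S') (θ : A.Con) :
    (reductAlgebra φ A).Con where
  toSetoid := θ.toSetoid
  compat n f := θ.compat n (φ.onFunction f)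

/-- The join of the equivalence relations is already compatible, by changing one argument at a time.
Hence joins do not depend on the signature, and modularity passes from a reduct to its expansion. -/
theorem Congruence.toSetoid_sup {A : Type u} [S.Structure A] (θ ψ : Congruence S A) :
    (θ ⊔ ψ).toSetoid = θ.toSetoid ⊔ ψ.toSetoid := by
  let j : Congruence S A :=
    { toSetoid := θ.toSetoid ⊔ ψ.toSetoid
      compat := fun n f x y h => by
        refine rel_of_forall_update _ (fun a b => (θ.toSetoid ⊔ ψ.toSetoid) a b) (funMap f)
          (fun x i a b hab => ?_) x y h
        have key : ∀ χ : Congruence S A,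
            χ.toSetoid ≤ (χ.toSetoid).comap fun a => funMap f (Function.update x i a) := by
          intro χ a b hab
          refine χ.compat n f _ _ fun k => ?_
          by_cases hk : k = i
          · subst hk; simpa using hab
          · simp [hk]
        have h2 : θ.toSetoid ⊔ ψ.toSetoid ≤
            (θ.toSetoid ⊔ ψ.toSetoid).comap fun a => funMap f (Function.update x i a) :=
          sup_le (fun a b h => (le_sup_left : θ.toSetoid ≤ θ.toSetoid ⊔ ψ.toSetoid) (key θ h))
            (fun a b h => (le_sup_right : ψ.toSetoid ≤ θ.toSetoid ⊔ ψ.toSetoid) (key ψ h))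
        exact h2 hab }
  refine le_antisymm ?_ (sup_le ?_ ?_)
  · have h : θ ⊔ ψ ≤ j :=
      sup_le (fun a b h => (le_sup_left : θ.toSetoid ≤ θ.toSetoid ⊔ ψ.toSetoid) h)
        (fun a b h => (le_sup_right : ψ.toSetoid ≤ θ.toSetoid ⊔ ψ.toSetoid) h)
    exact fun {a b} => h a b
  · exact fun {a b} => (le_sup_left : θ ≤ θ ⊔ ψ) a b
  · exact fun {a b} => (le_sup_right : ψ ≤ θ ⊔ ψ) a b

theorem isModularLattice_of_reduct (φ : S →ᴸ S') (A : AlgebraOver S')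
    [IsModularLattice (reductAlgebra φ A).Con] : IsModularLattice A.Con where
  sup_inf_le_assoc_of_le {x} y {z} hxz := by
    let r := reductCongruence φ A
    have hsup : ∀ θ ψ, r (θ ⊔ ψ) = r θ ⊔ r ψ := fun θ ψ =>
      Congruence.ext ((toSetoid_sup θ ψ).trans (toSetoid_sup (r θ) (r ψ)).symm)
    have hinf : ∀ θ ψ, r (θ ⊓ ψ) = r θ ⊓ r ψ := fun θ ψ =>
      Congruence.ext <| Setoid.ext fun a b =>
        (inf_rel θ ψ a b).trans (inf_rel (r θ) (r ψ) a b).symm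
    have hle : r ((x ⊔ y) ⊓ z) ≤ r (x ⊔ y ⊓ z) := by
      rw [hinf, hsup, hsup, hinf]
      exact IsModularLattice.sup_inf_le_assoc_of_le _ hxz
    exact hle

end Varieties

/-! ### Solvability and expansions by a binary operation -/

section Solvability

open Congruence

namespace UniversalAlgebra

theorem exists_latticeHom_bool_of_not_isSolvable (A : UniversalAlgebra.{u})
    (hA : A.GeneratesCongruenceModularVariety) [WellFoundedLT A.Con] (hS : ¬ A.IsSolvable) :
    ∃ f : LatticeHom A.Con Bool, Function.Surjective f := by
  have hM : ∀ β : A.Con, IsModularLattice (Congruence A.sig β.Pairs) := fun β =>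
    hA _ (pairAlgebra_mem (isVariety_generatedVariety A.alg) (mem_generatedVariety A.alg) β)
  obtain ⟨_, ⟨m, rfl⟩, hmin⟩ := wellFounded_lt.has_min
    (Set.range (derivedSeries A.sig A.alg.Carrier)) (Set.range_nonempty _)
  refine exists_latticeHom_bool_of_perfect commutator (commutator_comm hM) commutator_le_left
    (fun x y z => haveI := hM z; commutator_sup_left x y z)
    (g := derivedSeries A.sig A.alg.Carrier m) (fun h => hS ⟨m, h⟩) ?_
  exact (commutator_le_left _ _).eq_of_not_lt (hmin _ ⟨m + 1, rfl⟩)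

end UniversalAlgebra

/-- The signature with a single binary operation symbol. -/
inductive BinaryOp : ℕ → Type u
  | op : BinaryOp 2

/-- The language with a single binary operation symbol. -/
def binaryLanguage : FirstOrder.Language.{u, 0} := ⟨BinaryOp, fun _ => Empty⟩

instance : binaryLanguage.{u}.IsAlgebraic := fun _ => inferInstanceAs (IsEmpty Empty)

/-- The structure given by a binary operation. -/
@[reducible]
def binaryStructure {A : Type u} (g : A → A → A) : binaryLanguage.{u}.Structure A where
  funMap {n} f := match n, f with
    | _, .op => fun x => g (x 0) (x 1)
  RelMap r _ := Empty.elim r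

namespace UniversalAlgebra

/-- The expansion of an algebra by a binary operation. -/
def expand (A : UniversalAlgebra.{u}) (g : A.alg.Carrier → A.alg.Carrier → A.alg.Carrier) :
    UniversalAlgebra.{u} :=
  letI := A.algebraic
  { sig := A.sig.sum binaryLanguage
    algebraic := inferInstance
    alg :=
      { Carrier := A.alg.Carrier
        str := letI := binaryStructure g; inferInstance } }

variable {A : UniversalAlgebra.{u}} {g : A.alg.Carrier → A.alg.Carrier → A.alg.Carrier}

/-- Algebras whose reduct lies in `V` form a variety containing the expansion, hence containing all
it generates. -/
theorem expand_generatesCongruenceModularVariety (hA : A.InCongruenceModularVariety) :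
    (A.expand g).GeneratesCongruenceModularVariety := by
  obtain ⟨V, hV, hM, hAV⟩ := hA
  intro B hB
  have h : reductAlgebra (LHom.sumInl : A.sig →ᴸ A.sig.sum binaryLanguage) B ∈ V :=
    hB _ ⟨isVariety_preimage_reduct LHom.sumInl hV, hAV⟩
  have := hM _ h
  exact isModularLattice_of_reduct (LHom.sumInl : A.sig →ᴸ A.sig.sum binaryLanguage) B

/-- Expanding by an operation that preserves all congruences does not change the congruence
lattice. -/
def conExpandIso
    (hg : ∀ (θ : A.Con) (a b c d), θ.Rel a b → θ.Rel c d → θ.Rel (g a c) (g b d)) :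
    A.Con ≃o (A.expand g).Con where
  toFun θ :=
    { toSetoid := θ.toSetoid
      compat := fun n f x y h => match n, f with
        | n, Sum.inl f => θ.compat n f x y h
        | _, Sum.inr .op => hg θ _ _ _ _ (h 0) (h 1) }
  invFun θ :=
    { toSetoid := θ.toSetoid
      compat := fun n f x y h => θ.compat n (Sum.inl f) x y h }
  left_inv _ := rfl
  right_inv _ := rfl
  map_rel_iff' := Iff.rfl

/-- The new operation as a term. -/
def expandTerm (A : UniversalAlgebra.{u})
    (g : A.alg.Carrier → A.alg.Carrier → A.alg.Carrier) : (A.expand g).sig.Term (Fin 2) :=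
  Term.func (l := 2) (Sum.inr BinaryOp.op) Term.var

/-- If the expansion contains a semilattice operation on a two-element subset of `β` whose
elements are separated by all congruences not above `β`, then the expansion is not solvable. -/
theorem not_isSolvable_expand {β : (A.expand g).Con} {o e : A.alg.Carrier}
    (hβ : β.Rel o e) (hmin : ∀ θ : (A.expand g).Con, θ.Rel o e → β ≤ θ) (hne : o ≠ e)
    (hoo : g o o = o) (hoe : g o e = o) (heo : g e o = o) (hee : g e e = e) :
    ¬ (A.expand g).IsSolvable := by
  rintro ⟨m, hm⟩
  have key : ∀ m, β ≤ derivedSeries (A.expand g).sig (A.expand g).alg.Carrier m := by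
    intro m
    induction m with
    | zero => exact le_top
    | succ m ih =>
      refine le_sInf fun δ hδ => hmin δ ?_
      -- From g(o, o) = g(o, e) = o the term condition yields that g(e, o) = o and g(e, e) = e are
      -- δ-related.
      have h := hδ 1 (A.expandTerm g) o e (fun _ => o) (fun _ => e) (ih _ _ hβ)
        (fun _ => ih _ _ hβ)
      change δ.Rel (g o o) (g o e) → δ.Rel (g e o) (g e e) at h
      rw [hoo, hoe, heo, hee] at h
      exact h (δ.refl o)
  exact hne ((bot_rel (A := (A.expand g).alg.Carrier) o e).1 (hm ▸ key m o e hβ))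

theorem exists_expand_not_isSolvable {α β : A.Con} (hαβ : ¬ β ≤ α)
    (hsplit : ∀ θ, β ≤ θ ∨ θ ≤ α) :
    ∃ g, Nonempty (A.Con ≃o (A.expand g).Con) ∧ ¬ (A.expand g).IsSolvable := by
  classical
  obtain ⟨o, e, hβ, hα⟩ : ∃ o e, β.Rel o e ∧ ¬ α.Rel o e := by
    by_contra! h
    exact hαβ h
  let g : A.alg.Carrier → A.alg.Carrier → A.alg.Carrier :=
    fun x y => if α.Rel x e ∧ α.Rel y e then e else o
  have hg : ∀ (θ : A.Con) (a b c d), θ.Rel a b → θ.Rel c d → θ.Rel (g a c) (g b d) := by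
    intro θ a b c d hab hcd
    rcases hsplit θ with hθ | hθ
    · have h := hθ _ _ hβ
      by_cases h1 : α.Rel a e ∧ α.Rel c e <;> by_cases h2 : α.Rel b e ∧ α.Rel d e <;>
        simp only [g, h1, h2, if_false]
      exacts [θ.refl e, θ.symm h, h, θ.refl o]
    · have h1 : ∀ {x y}, θ.Rel x y → (α.Rel x e ↔ α.Rel y e) := fun h =>
        ⟨α.trans (α.symm (hθ _ _ h)), α.trans (hθ _ _ h)⟩
      have h2 : g a c = g b d := by simp only [g, h1 hab, h1 hcd]
      rw [h2]
      exact θ.refl _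
  have hee : α.Rel e e := α.refl e
  refine ⟨g, ⟨conExpandIso hg⟩, not_isSolvable_expand (β := conExpandIso hg β) hβ
    (fun θ hθ => ?_) (fun h => hα (h ▸ α.refl o)) ?_ ?_ ?_ ?_⟩
  · rw [← (conExpandIso hg).apply_symm_apply θ, (conExpandIso hg).le_iff_le]
    -- A congruence containing (o, e) is not below α, so it is above β.
    exact (hsplit _).resolve_right fun h => hα (h o e hθ)
  all_goals simp [g, hα, hee]

end UniversalAlgebra

end Solvability

end UA

theorem mainTheorem1 (L : Type w) [Lattice L] [FiniteDimensionalOrder L]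
    (hL : ∃ A : UA.UniversalAlgebra.{u}, A.InCongruenceModularVariety ∧ Nonempty (A.Con ≃o L)) :
    List.TFAE
      [UA.Forces L UA.UniversalAlgebra.IsSolvable
          {A : UA.UniversalAlgebra.{u} | A.GeneratesCongruenceModularVariety},
        ∀ B : UA.UniversalAlgebra.{u}, B.GeneratesCongruenceModularVariety →
          Nonempty (B.Con ≃o L) → B.IsSolvable,
        ¬ UA.IsHomomorphicImage Bool L] := by
  have := UA.wellFoundedLT_of_finiteDimensionalOrder L
  have := UA.wellFoundedGT_of_finiteDimensionalOrder L
  tfae_have 1 ↔ 2 := Iff.rfl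
  tfae_have 2 → 3 := by
    rintro h ⟨f, hf⟩
    -- Only an algebra inside some modular variety is given; its expansion generates one and has the
    -- same congruence lattice.
    obtain ⟨A, hA, ⟨i⟩⟩ := hL
    obtain ⟨a, b, hab, hsplit⟩ := UA.exists_splitting f hf
    obtain ⟨g, ⟨j⟩, hg⟩ := UA.UniversalAlgebra.exists_expand_not_isSolvable (A := A)
      (α := i.symm a) (β := i.symm b) (by simpa using hab) fun θ => by
        simpa [i.symm_apply_le, i.le_symm_apply] using hsplit (i θ)
    exact hg (h _ (UA.UniversalAlgebra.expand_generatesCongruenceModularVariety hA)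
      ⟨j.symm.trans i⟩)
  tfae_have 3 → 2 := by
    rintro h B hB ⟨i⟩
    by_contra hS
    have : WellFoundedLT B.Con := i.toOrderEmbedding.wellFoundedLT
    obtain ⟨f, hf⟩ := B.exists_latticeHom_bool_of_not_isSolvable hB hS
    exact h ⟨f.comp (i.symm : LatticeHom L B.Con), hf.comp i.symm.surjective⟩
  tfae_finish
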